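/- Network. Let $\mathcal J$ be a finite set of queues and $\mathcal I$ a finite set of routes; each route $i\in\mathcal I$ has a non-empty ordered list of queues (repetitions allowed), $\zeta_{ji}$ is the number of times queue $j$ occurs in the list of route $i$, and $j\in i$ means $\zeta_{ji}>0$. For each queue $j$ let $\phi_j:\mathbb Z_+\to\mathbb R$ satisfy $\phi_j(m)>0$ for $m>0$. For $n\in\mathbb Z_+^{\mathcal I}$ let $S(n)$ be the set of all $m=(m_{ji}\in\mathbb Z_+: i\in\mathcal I,\ j\in i)$ with $\sum_{j\in i}m_{ji}=n_i$ for all $i$, write $m_j=\sum_{i\ni j}m_{ji}$, and put $$B_n=\sum_{m\in S(n)}\ \prod_{j\in\mathcal J}\left(\frac{m_j!}{\prod_{i\ni j}m_{ji}!}\cdot\frac{\prod_{i\ni j}\zeta_{ji}^{m_{ji}}}{\prod_{l=1}^{m_j}\phi_j(l)}\right),\qquad \Lambda^{SN}_i(n)=\frac{B_{n-e_i}}{B_n}\ \text{ if } n_i>0,\qquad \Lambda^{SN}_i(n)=0\ \text{ if } n_i=0,$$ where $e_i$ is the $i$-th unit vector. Spinning network. At time $0$ there are $N_i(0)\in\mathbb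 Z_+$ documents in transfer on route $i$, with residual sizes $Y_{ik}>0$, $k=1,\dots,N_i(0)$ (labelled in an arbitrary way, not necessarily in increasing order). Documents on route $i$ arrive as a Poisson process of rate $\nu_i>0$ (that is, with i.i.d. exponential inter-arrival times of rate $\nu_i$), and the arriving documents have i.i.d. sizes distributed as a positive random variable $X_i$ with finite mean. The arrival processes of the different routes, all sizes of arriving documents, and the initial state $(N(0),(Y_{ik}))$ are mutually independent. Between consecutive events, when $n_i$ documents are in transfer on route $i$, the residual size of each of them decreases linearly at rate $\Lambda^{SN}_i(n)/n_i$; a document departs at the instant its residual size becomes $0$. An event is the arrival of a document after time $0$, or the departure of a document. Lemma. Suppose that, for every $n$ with $\mathbb P(N(0)=n)>0$, conditionally on $N(0)=n$ the initial residual sizes $Y_{ik}$, $i\in\mathcal I$, $1\le k\le n_i$, are independent and each is non-atomic (it takes any given value with probability $0$), and suppose that each document size distribution $X_i$, $i\in\mathcal I$, is non-atomic. Then: (a) almost surely, there are no simultaneous events, i.e. no two distinct arrival or departure events occur at the same time; (b) for every fixed $t\in\mathbb R_+$, almost surely, no event occurs at time $t$. -/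

import Mathlib

open MeasureTheory ProbabilityTheory

namespace SpinningNet

/-- The deterministic data of a multi-class queueing network: finitely many routes `I`, finitely
many queues `J`, for each route the ordered list of the queues it visits (repetitions allowed), and
the service capacity `φ j m` of queue `j` when it holds `m` packets. -/
structure QueueNetwork (I J : Type*) where
  order : I → List J
  order_ne_nil : ∀ i, order i ≠ []
  φ : J → ℕ → ℝ
  φ_pos : ∀ j m, 0 < m → 0 < φ j m

section Allocation

variable {I J : Type*} [Fintype I] [Fintype J]

open Classical in
/-- `ζ_{ji}`: how often route `i` visits queue `j` in one traversal. -/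
noncomputable def QueueNetwork.visits (Q : QueueNetwork I J) (j : J) (i : I) : ℕ :=
  (Q.order i).count j

open Classical in
/-- `S(n)`: the arrays `m i j` (number of route `i` packets at queue `j`), supported on the pairs
with `j` on route `i`, such that `∑ j, m i j = n i` for every route `i`. -/
noncomputable def QueueNetwork.packetStates (Q : QueueNetwork I J) (n : I → ℕ) :
    Finset (I → J → ℕ) :=
  Fintype.piFinset fun i => (Q.order i).toFinset.piAntidiag (n i)

/-- The normalising constant
`B_n = ∑_{m ∈ S(n)} ∏_j (m_j; (m_{ji})_i) ∏_i ζ_{ji} ^ m_{ji} / ∏_{l=1}^{m_j} φ_j(l)`,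
where `m_j = ∑_i m_{ji}` and the first factor is the multinomial coefficient. Routes that avoid `j`
have `m_{ji} = 0` and contribute a factor `1`. -/
noncomputable def QueueNetwork.B (Q : QueueNetwork I J) (n : I → ℕ) : ℝ :=
  ∑ m ∈ Q.packetStates n, ∏ j : J,
    ((Nat.multinomial Finset.univ (fun i => m i j) : ℝ) *
      ((∏ i : I, (Q.visits j i : ℝ) ^ m i j) / ∏ l ∈ Finset.Icc 1 (∑ i : I, m i j), Q.φ j l))

open Classical in
/-- The spinning allocation `Λ_i(n) = B_{n - e_i} / B_n`; it is `0` if there is no document on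
route `i`. -/
noncomputable def QueueNetwork.spinningAllocation (Q : QueueNetwork I J) (n : I → ℕ) (i : I) : ℝ :=
  if n i = 0 then 0 else Q.B (n - Pi.single i 1) / Q.B n

end Allocation

/-- Labels of documents: `(i, .inl k)` is the `k`-th of the documents present on route `i` at time
`0`, and `(i, .inr m)` is the `m`-th document to arrive on route `i` after time `0` (labels start
from `0`). -/
abbrev Doc (I : Type*) := I × (ℕ ⊕ ℕ)

/-- The input of one sample path: the number `N₀ i` of documents initially present on route `i`,
their residual sizes `y₀ i k` (only `k < N₀ i` matters), the successive inter-arrival times `gap i m`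
of the documents of route `i`, and the sizes `size i m` of these arriving documents. -/
structure Input (I : Type*) where
  N₀ : I → ℕ
  y₀ : I → ℕ → ℝ
  gap : I → ℕ → ℝ
  size : I → ℕ → ℝ

/-- The arrival time of the `m`-th document to arrive on route `i`. -/
noncomputable def Input.arrivalTime {I : Type*} (u : Input I) (i : I) (m : ℕ) : ℝ :=
  ∑ l ∈ Finset.range (m + 1), u.gap i l

/-- The state just after an arrival-departure event: the time of the event, the number of arrivals
so far on each route, the documents in transfer, and the part of each document that is still to be
transferred (the full size, for a document that has not arrived yet). -/
structure State (I : Type*) where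
  time : ℝ
  arrived : I → ℕ
  active : Finset (Doc I)
  residual : Doc I → ℝ

section Dynamics

variable {I : Type*} [Fintype I]

open Classical in
/-- The number `n i` of documents in transfer on route `i`. -/
noncomputable def State.count (s : State I) (i : I) : ℕ :=
  (s.active.filter fun d => d.1 = i).card

/-- Under the bandwidth allocation policy `Λ`, each document on route `i` is transferred at rate
`Λ_i(n) / n_i`. -/
noncomputable def State.rate (s : State I) (Λ : (I → ℕ) → I → ℝ) (d : Doc I) : ℝ :=
  Λ s.count d.1 / s.count d.1

open Classical in
/-- The residual size of a document at time `t`, if no event occurs between `s.time` and `t`. -/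
noncomputable def State.residualAt (s : State I) (Λ : (I → ℕ) → I → ℝ) (t : ℝ) (d : Doc I) : ℝ :=
  if d ∈ s.active then s.residual d - s.rate Λ d * (t - s.time) else s.residual d

/-- The time of the next event: the first time at which the residual size of a document in transfer
reaches `0` or a new document arrives. -/
noncomputable def State.nextTime (s : State I) (Λ : (I → ℕ) → I → ℝ) (u : Input I) : ℝ :=
  sInf {t : ℝ | s.time ≤ t ∧
    ((∃ d ∈ s.active, s.residualAt Λ t d = 0) ∨ ∃ i, u.arrivalTime i (s.arrived i) = t)}

open Classical in
/-- The documents that depart at the next event: all those whose residual size is then `0`. -/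
noncomputable def State.departing (s : State I) (Λ : (I → ℕ) → I → ℝ) (u : Input I) :
    Finset (Doc I) :=
  s.active.filter fun d => s.residualAt Λ (s.nextTime Λ u) d = 0

open Classical in
/-- The routes on which a document arrives at the next event. -/
noncomputable def State.arrivingRoutes (s : State I) (Λ : (I → ℕ) → I → ℝ) (u : Input I) :
    Finset I :=
  Finset.univ.filter fun i => u.arrivalTime i (s.arrived i) = s.nextTime Λ u

open Classical in
/-- The documents that arrive at the next event. -/
noncomputable def State.arriving (s : State I) (Λ : (I → ℕ) → I → ℝ) (u : Input I) :
    Finset (Doc I) :=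
  (s.arrivingRoutes Λ u).image fun i => (i, Sum.inr (s.arrived i))

open Classical in
/-- The state just after the next event. -/
noncomputable def State.next (s : State I) (Λ : (I → ℕ) → I → ℝ) (u : Input I) : State I where
  time := s.nextTime Λ u
  arrived i := if i ∈ s.arrivingRoutes Λ u then s.arrived i + 1 else s.arrived i
  active := (s.active \ s.departing Λ u) ∪ s.arriving Λ u
  residual := s.residualAt Λ (s.nextTime Λ u)

open Classical in
/-- The state at time `0`. -/
noncomputable def Input.initial (u : Input I) : State I where
  time := 0
  arrived _ := 0
  active := Finset.univ.biUnion fun i => (Finset.range (u.N₀ i)).image fun k => (i, Sum.inl k)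
  residual
    | (i, Sum.inl k) => u.y₀ i k
    | (i, Sum.inr m) => u.size i m

/-- The sample path of the generalised stochastic flow level model operating under the bandwidth
allocation policy `Λ`, recorded at its successive event times: `path Λ u κ` is the state just after
the `κ`-th event time. -/
noncomputable def path (Λ : (I → ℕ) → I → ℝ) (u : Input I) : ℕ → State I
  | 0 => u.initial
  | κ + 1 => (path Λ u κ).next Λ u

end Dynamics

/-- Document arrival-departure events. -/
inductive Event (I : Type*) where
  | arrival (d : Doc I) : Event I
  | departure (d : Doc I) : Event I

/-- On the sample path with input `u`, the event `e` occurs at time `t`. -/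
def OccursAt {I : Type*} [Fintype I] (Λ : (I → ℕ) → I → ℝ) (u : Input I) (t : ℝ) :
    Event I → Prop
  | .arrival d => ∃ κ, (path Λ u κ).nextTime Λ u = t ∧ d ∈ (path Λ u κ).arriving Λ u
  | .departure d => ∃ κ, (path Λ u κ).nextTime Λ u = t ∧ d ∈ (path Λ u κ).departing Λ u

end SpinningNet

/-!
# Spinning networks have no simultaneous events

The randomness of a sample path splits into a combinatorial part and a numerical part. Once it is
prescribed which documents arrive and depart at each step, and which of these events triggers the
step (a *script*), all event times and residual sizes are explicit functions of the inter-arrival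
times and document sizes (`scripted`), and there are only countably many scripts. On a regular input
the actual path follows a script (`exists_path_eq_scripted`).

The size of a document `d` enters such a path only through the time at which `d` departs. So as long
as the departure of `d` has triggered no step, changing the size of `d` changes nothing but the
residual size of `d`, by the same amount (`scripted_congr`). Suppose that `d` departs at a time `τ`
that does not involve its size: a fixed time, or the time at which another event is due. Then its
size equals the transfer it has received up to `τ`, a measurable function of all the other
coordinates of the input (`DepartsAt.residual_initial_eq`). A non-atomic coordinate of an
independent family almost surely avoids any such function (`ae_ne_of_iIndepFun`); the same fact,
applied to an inter-arrival time, excludes coincidences of arrival times. Countably many null events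
are discarded (`ae_no_coincidence`).

The coordinates are independent only conditionally on the numbers of documents initially present, so
the argument is run under each of these countably many conditional laws. It applies to every
allocation: the form of `Λ` plays no role, since a document whose residual size is constant and
non-zero never departs.
-/

namespace SpinningNet

/-! ### Invariants of sample paths -/

section SamplePath

variable {I : Type*}

/-- Regularity of an input, which holds almost surely: arrivals on one route are successive, and no
document has size `0`. -/
structure Input.Regular (u : Input I) : Prop where
  gap_pos : ∀ i m, 0 < u.gap i m
  size_ne_zero : ∀ i m, u.size i m ≠ 0
  y₀_ne_zero : ∀ i, ∀ k < u.N₀ i, u.y₀ i k ≠ 0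

/-- The label `d` belongs to an actual document when `n i` documents are initially present on each
route `i`: the labels `(i, .inl k)` with `n i ≤ k` are void. -/
def IsDoc (n : I → ℕ) (d : Doc I) : Prop :=
  ∀ k, d.2 = Sum.inl k → k < n d.1

lemma Input.arrivalTime_succ (u : Input I) (i : I) (m : ℕ) :
    u.arrivalTime i (m + 1) = u.arrivalTime i m + u.gap i (m + 1) :=
  Finset.sum_range_succ _ _

lemma Input.Regular.arrivalTime_pos {u : Input I} (hu : u.Regular) (i : I) (m : ℕ) :
    0 < u.arrivalTime i m :=
  Finset.sum_pos (fun l _ => hu.gap_pos i l) (by simp)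

/-- Invariants of the states on a sample path with a regular input. -/
structure State.Sound (u : Input I) (s : State I) : Prop where
  isDoc : ∀ d ∈ s.active, IsDoc u.N₀ d
  lt_arrived : ∀ i m, (i, Sum.inr m) ∈ s.active → m < s.arrived i
  residual_ne_zero : ∀ d ∈ s.active, s.residual d ≠ 0
  residual_of_arrived_le : ∀ i m, s.arrived i ≤ m → s.residual (i, Sum.inr m) = u.size i m
  time_lt : ∀ i, s.time < u.arrivalTime i (s.arrived i)

variable {Λ : (I → ℕ) → I → ℝ} {u v : Input I} {s : State I}

lemma State.mem_departing {d : Doc I} :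
    d ∈ s.departing Λ u ↔ d ∈ s.active ∧ s.residualAt Λ (s.nextTime Λ u) d = 0 := by
  simp [State.departing]

lemma State.Sound.nextTime_le_arrivalTime (hs : s.Sound u) (i : I) :
    s.nextTime Λ u ≤ u.arrivalTime i (s.arrived i) :=
  csInf_le ⟨s.time, fun _ ht => ht.1⟩ ⟨(hs.time_lt i).le, Or.inr ⟨i, rfl⟩⟩

lemma State.rate_congr {s' : State I} (hact : s.active = s'.active) (d : Doc I) :
    s.rate Λ d = s'.rate Λ d := by
  have hcount : s.count = s'.count := funext fun i => by rw [State.count, State.count, hact]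
  rw [State.rate, State.rate, hcount]

lemma State.residualAt_sub_residualAt {s' : State I} (htime : s.time = s'.time)
    (hact : s.active = s'.active) (t : ℝ) (d : Doc I) :
    s.residualAt Λ t d - s'.residualAt Λ t d = s.residual d - s'.residual d := by
  rw [State.residualAt, State.residualAt, State.rate_congr hact, htime]
  by_cases hd : d ∈ s'.active
  · rw [if_pos (hact ▸ hd), if_pos hd]
    ring
  · rw [if_neg (hact ▸ hd), if_neg hd]

/-- The time at which the event `c` is due when the state is `s`. For `c = .inr d` this is
meaningful only if `d` is transferred at a non-zero rate. -/
noncomputable def State.dueTime (s : State I) (Λ : (I → ℕ) → I → ℝ) (u : Input I) :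
    I ⊕ Doc I → ℝ
  | Sum.inl i => u.arrivalTime i (s.arrived i)
  | Sum.inr d => s.time + s.residual d / s.rate Λ d

lemma State.Sound.dueTime_eq_nextTime (hs : s.Sound u) {d : Doc I} (hd : d ∈ s.departing Λ u) :
    s.dueTime Λ u (Sum.inr d) = s.nextTime Λ u := by
  obtain ⟨hact, h0⟩ := State.mem_departing.1 hd
  rw [State.residualAt, if_pos hact] at h0
  -- A document that keeps a constant non-zero residual size never departs.
  have hrate : s.rate Λ d ≠ 0 := by
    intro h
    rw [h, zero_mul, sub_zero] at h0
    exact hs.residual_ne_zero d hact h0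
  rw [State.dueTime]
  field_simp
  linarith

variable [Fintype I]

lemma Input.Regular.sound_initial (hu : u.Regular) : u.initial.Sound u where
  isDoc := by
    rintro ⟨i, k⟩ hd k' rfl
    simpa [Input.initial] using hd
  lt_arrived i m h := by simp [Input.initial] at h
  residual_ne_zero := by
    rintro ⟨i, k | m⟩ hd
    · exact hu.y₀_ne_zero i k (by simpa [Input.initial] using hd)
    · simp [Input.initial] at hd
  residual_of_arrived_le i m _ := rfl
  time_lt i := hu.arrivalTime_pos i 0

lemma State.mem_arriving {d : Doc I} :
    d ∈ s.arriving Λ u ↔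
      u.arrivalTime d.1 (s.arrived d.1) = s.nextTime Λ u ∧ d.2 = Sum.inr (s.arrived d.1) := by
  obtain ⟨i, x⟩ := d
  simp only [State.arriving, State.arrivingRoutes, Finset.mem_image, Finset.mem_filter,
    Finset.mem_univ, true_and, Prod.mk.injEq]
  constructor
  · rintro ⟨j, hj, rfl, rfl⟩
    exact ⟨hj, rfl⟩
  · rintro ⟨h, rfl⟩
    exact ⟨i, h, rfl, rfl⟩

lemma State.mem_active_next {d : Doc I} :
    d ∈ (s.next Λ u).active ↔ (d ∈ s.active ∧ d ∉ s.departing Λ u) ∨ d ∈ s.arriving Λ u := by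
  simp [State.next]

lemma State.arrived_next (i : I) : (s.next Λ u).arrived i =
    if u.arrivalTime i (s.arrived i) = s.nextTime Λ u then s.arrived i + 1 else s.arrived i := by
  simp [State.next, State.arrivingRoutes]

lemma State.arrived_le_next (i : I) : s.arrived i ≤ (s.next Λ u).arrived i := by
  rw [State.arrived_next]
  split_ifs <;> omega

/-- The times at which the residual size of a document in transfer vanishes or a document arrives
form a closed set, so the infimum that defines the next event time is attained. -/
lemma State.Sound.nextTime_mem (hs : s.Sound u) [Nonempty I] :
    s.time ≤ s.nextTime Λ u ∧ ((∃ d ∈ s.active, s.residualAt Λ (s.nextTime Λ u) d = 0) ∨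
      ∃ i, u.arrivalTime i (s.arrived i) = s.nextTime Λ u) := by
  have hclosed : IsClosed {t : ℝ | s.time ≤ t ∧
      ((∃ d ∈ s.active, s.residualAt Λ t d = 0) ∨ ∃ i, u.arrivalTime i (s.arrived i) = t)} := by
    have hset : {t : ℝ | s.time ≤ t ∧
        ((∃ d ∈ s.active, s.residualAt Λ t d = 0) ∨ ∃ i, u.arrivalTime i (s.arrived i) = t)} =
        Set.Ici s.time ∩ ((⋃ d ∈ s.active, {t | s.residualAt Λ t d = 0}) ∪
          ⋃ i, {t | u.arrivalTime i (s.arrived i) = t}) := by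
      ext t
      simp
    rw [hset]
    refine isClosed_Ici.inter (IsClosed.union ?_ ?_)
    · refine s.active.finite_toSet.isClosed_biUnion fun d _ => isClosed_eq ?_ continuous_const
      unfold State.residualAt
      split_ifs <;> fun_prop
    · exact isClosed_iUnion_of_finite fun i => isClosed_eq continuous_const continuous_id
  obtain ⟨i⟩ := ‹Nonempty I›
  exact hclosed.csInf_mem ⟨_, (hs.time_lt i).le, Or.inr ⟨i, rfl⟩⟩ ⟨s.time, fun t ht => ht.1⟩

lemma State.Sound.time_lt_nextTime (hs : s.Sound u) [Nonempty I] :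
    s.time < s.nextTime Λ u := by
  obtain ⟨hle, hev⟩ := hs.nextTime_mem (Λ := Λ)
  refine lt_of_le_of_ne hle fun heq => ?_
  rcases hev with ⟨d, hd, h0⟩ | ⟨i, hi⟩
  · exact hs.residual_ne_zero d hd (by simpa [State.residualAt, hd, ← heq] using h0)
  · exact (hs.time_lt i).ne (heq.trans hi.symm)

/-- A residual size that vanishes at the next event belongs to a departing document, and positive
gaps put the next arrivals strictly later: the invariants persist. -/
lemma State.Sound.next (hu : u.Regular) (hs : s.Sound u) : (s.next Λ u).Sound u where
  isDoc d hd := by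
    rcases State.mem_active_next.1 hd with ⟨h, _⟩ | h
    · exact hs.isDoc d h
    · intro k hk
      simp [(State.mem_arriving.1 h).2] at hk
  lt_arrived i m hd := by
    rcases State.mem_active_next.1 hd with ⟨h, _⟩ | h
    · exact (hs.lt_arrived i m h).trans_le (State.arrived_le_next i)
    · obtain ⟨h1, h2⟩ := State.mem_arriving.1 h
      have h2' : m = s.arrived i := by simpa using h2
      rw [State.arrived_next, if_pos h1, h2']
      exact Nat.lt_succ_self _
  residual_ne_zero d hd := by
    change s.residualAt Λ (s.nextTime Λ u) d ≠ 0
    rcases State.mem_active_next.1 hd with ⟨h, h'⟩ | h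
    · exact fun h0 => h' (State.mem_departing.2 ⟨h, h0⟩)
    · obtain ⟨i, x⟩ := d
      obtain rfl : x = Sum.inr (s.arrived i) := (State.mem_arriving.1 h).2
      rw [State.residualAt, if_neg fun hact => (hs.lt_arrived _ _ hact).false,
        hs.residual_of_arrived_le _ _ le_rfl]
      exact hu.size_ne_zero _ _
  residual_of_arrived_le i m hm := by
    have hm' := (State.arrived_le_next i).trans hm
    change s.residualAt Λ (s.nextTime Λ u) (i, Sum.inr m) = _
    rw [State.residualAt, if_neg fun hact => (hs.lt_arrived _ _ hact).not_ge hm',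
      hs.residual_of_arrived_le _ _ hm']
  time_lt i := by
    change s.nextTime Λ u < _
    rw [State.arrived_next]
    split_ifs with h
    · rw [Input.arrivalTime_succ, h]
      exact lt_add_of_pos_right _ (hu.gap_pos i _)
    · exact lt_of_le_of_ne (hs.nextTime_le_arrivalTime i) (Ne.symm h)

lemma sound_path (hu : u.Regular) (κ : ℕ) : (path Λ u κ).Sound u := by
  induction κ with
  | zero => exact hu.sound_initial
  | succ κ ih => exact ih.next hu

/-- Distinct steps happen at distinct times, so simultaneous events belong to the same step. -/
lemma nextTime_path_injective [Nonempty I] (hu : u.Regular) :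
    Function.Injective fun κ => (path Λ u κ).nextTime Λ u := by
  have hmono : StrictMono fun κ => (path Λ u κ).time :=
    strictMono_nat_of_lt_succ fun κ => (sound_path hu κ).time_lt_nextTime
  intro κ κ' h
  exact Nat.succ_injective (hmono.injective h)

/-! ### Scripted paths -/

/-- The combinatorial part of one step of a sample path: the event that triggers the step (the
arrival of the next document of a route, or the departure of a document), the documents that
depart, and the routes on which a document arrives. -/
abbrev Step (I : Type*) := (I ⊕ Doc I) × Finset (Doc I) × Finset I

open Classical in
/-- The state after a step whose combinatorial part is prescribed to be `c`. -/
noncomputable def State.follow (s : State I) (Λ : (I → ℕ) → I → ℝ) (u : Input I) (c : Step I) :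
    State I where
  time := s.dueTime Λ u c.1
  arrived i := if i ∈ c.2.2 then s.arrived i + 1 else s.arrived i
  active := (s.active \ c.2.1) ∪ c.2.2.image fun i => (i, Sum.inr (s.arrived i))
  residual := s.residualAt Λ (s.dueTime Λ u c.1)

/-- The state reached when the combinatorial parts of all steps are prescribed, latest step first.
In contrast to `path`, its numerical parts are affine functions of the inter-arrival times and the
document sizes. -/
noncomputable def scripted (Λ : (I → ℕ) → I → ℝ) (u : Input I) : List (Step I) → State I
  | [] => u.initial
  | c :: h => (scripted Λ u h).follow Λ u c

/-- The event `c` is not the departure of `d`, and not the departure of a void label. -/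
def Avoids (n : I → ℕ) (d : Doc I) (c : I ⊕ Doc I) : Prop :=
  ∀ d', c = Sum.inr d' → d' ≠ d ∧ IsDoc n d'

lemma State.next_eq_follow {c : I ⊕ Doc I} (hc : s.dueTime Λ u c = s.nextTime Λ u) :
    s.next Λ u = s.follow Λ u (c, s.departing Λ u, s.arrivingRoutes Λ u) := by
  simp only [State.next, State.follow, State.arriving, hc]

/-- The path follows a script, none of whose steps is triggered by the departure of a document that
is still in transfer at the end. -/
lemma exists_path_eq_scripted [Nonempty I] (hu : u.Regular) (κ : ℕ) :
    ∃ h : List (Step I), path Λ u κ = scripted Λ u h ∧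
      ∀ d ∈ (path Λ u κ).active, ∀ c ∈ h, Avoids u.N₀ d c.1 := by
  -- A departed document stays away: it is not in transfer, and has arrived already.
  suffices H : ∃ h : List (Step I), path Λ u κ = scripted Λ u h ∧
      ∀ c ∈ h, ∀ d, c.1 = Sum.inr d → IsDoc u.N₀ d ∧ d ∉ (path Λ u κ).active ∧
        ∀ m, d.2 = Sum.inr m → m < (path Λ u κ).arrived d.1 by
    obtain ⟨h, h1, h2⟩ := H
    refine ⟨h, h1, fun d hd c hc d' hd' => ⟨?_, (h2 c hc d' hd').1⟩⟩
    rintro rfl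
    exact (h2 c hc d' hd').2.1 hd
  induction κ with
  | zero => exact ⟨[], rfl, by simp⟩
  | succ κ ih =>
    obtain ⟨h, h1, h2⟩ := ih
    have hs : (path Λ u κ).Sound u := sound_path hu κ
    have hgone : ∀ d, d ∉ (path Λ u κ).active ∨ d ∈ (path Λ u κ).departing Λ u →
        (∀ m, d.2 = Sum.inr m → m < (path Λ u κ).arrived d.1) →
        d ∉ (path Λ u (κ + 1)).active ∧
          ∀ m, d.2 = Sum.inr m → m < (path Λ u (κ + 1)).arrived d.1 := by
      intro d hd hm
      refine ⟨fun hact => ?_, fun m h => (hm m h).trans_le (State.arrived_le_next _)⟩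
      rcases State.mem_active_next.1 hact with ⟨h, h'⟩ | h
      · tauto
      · exact (hm _ (State.mem_arriving.1 h).2).false
    obtain ⟨c, hc, hc'⟩ : ∃ c, (path Λ u κ).dueTime Λ u c = (path Λ u κ).nextTime Λ u ∧
        ∀ d, c = Sum.inr d → d ∈ (path Λ u κ).departing Λ u := by
      rcases (hs.nextTime_mem (Λ := Λ)).2 with ⟨d, hd, h0⟩ | ⟨i, hi⟩
      · have hdep := State.mem_departing.2 ⟨hd, h0⟩
        refine ⟨Sum.inr d, hs.dueTime_eq_nextTime hdep, ?_⟩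
        rintro d' ⟨⟩
        exact hdep
      · exact ⟨Sum.inl i, hi, by simp⟩
    refine ⟨(c, (path Λ u κ).departing Λ u, (path Λ u κ).arrivingRoutes Λ u) :: h, ?_, ?_⟩
    · rw [path, State.next_eq_follow hc, scripted, ← h1]
    · intro c' hmem d hd
      rcases List.mem_cons.1 hmem with rfl | hmem
      · have hdep := hc' d hd
        have hact := (State.mem_departing.1 hdep).1
        refine ⟨hs.isDoc d hact, hgone d (Or.inr hdep) fun m hm => hs.lt_arrived d.1 m ?_⟩
        rw [← hm]
        exact hact
      · obtain ⟨h3, h4, h5⟩ := h2 c' hmem d hd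
        exact ⟨h3, hgone d (Or.inl h4) h5⟩

/-- Two inputs that differ only in the sizes of documents whose departures trigger no step of the
script lead to the same state, up to the initial differences in these sizes. -/
lemma scripted_congr (hN : u.N₀ = v.N₀) (hgap : u.gap = v.gap) (h : List (Step I))
    (hinit : ∀ c ∈ h, ∀ d, c.1 = Sum.inr d → u.initial.residual d = v.initial.residual d) :
    (scripted Λ u h).time = (scripted Λ v h).time ∧
      (scripted Λ u h).arrived = (scripted Λ v h).arrived ∧
      (scripted Λ u h).active = (scripted Λ v h).active ∧
      ∀ d, (scripted Λ u h).residual d - (scripted Λ v h).residual d =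
        u.initial.residual d - v.initial.residual d := by
  induction h with
  | nil => exact ⟨rfl, rfl, by simp [scripted, Input.initial, hN], fun d => rfl⟩
  | cons c h ih =>
    obtain ⟨htime, harr, hact, hres⟩ := ih fun c' hc' => hinit c' (List.mem_cons_of_mem _ hc')
    have hrate : ∀ d, (scripted Λ u h).rate Λ d = (scripted Λ v h).rate Λ d :=
      State.rate_congr hact
    have hdue : (scripted Λ u h).dueTime Λ u c.1 = (scripted Λ v h).dueTime Λ v c.1 := by
      rcases hc : c.1 with i | d
      · simp only [State.dueTime, Input.arrivalTime, harr, hgap]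
      · have := hres d
        rw [hinit c List.mem_cons_self d hc, sub_self, sub_eq_zero] at this
        simp only [State.dueTime, htime, hrate, this]
    refine ⟨hdue, ?_, ?_, fun d => ?_⟩
    · simp only [scripted, State.follow, harr]
    · simp only [scripted, State.follow, harr, hact]
    · rw [← hres d]
      simp only [scripted, State.follow, hdue]
      exact State.residualAt_sub_residualAt htime hact _ d

lemma residualAt_scripted_congr (hN : u.N₀ = v.N₀) (hgap : u.gap = v.gap) (h : List (Step I))
    (hinit : ∀ c ∈ h, ∀ d, c.1 = Sum.inr d → u.initial.residual d = v.initial.residual d)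
    (t : ℝ) (d : Doc I) :
    (scripted Λ u h).residualAt Λ t d - (scripted Λ v h).residualAt Λ t d =
      u.initial.residual d - v.initial.residual d := by
  obtain ⟨htime, -, hact, hres⟩ := scripted_congr (Λ := Λ) hN hgap h hinit
  rw [← hres d]
  exact State.residualAt_sub_residualAt htime hact t d

lemma dueTime_scripted_congr (hN : u.N₀ = v.N₀) (hgap : u.gap = v.gap) (h : List (Step I))
    (hinit : ∀ c ∈ h, ∀ d, c.1 = Sum.inr d → u.initial.residual d = v.initial.residual d)
    (c : I ⊕ Doc I)
    (hc : ∀ d, c = Sum.inr d → u.initial.residual d = v.initial.residual d) :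
    (scripted Λ u h).dueTime Λ u c = (scripted Λ v h).dueTime Λ v c := by
  -- The due time of `c` is the time of the script prolonged by a step that `c` triggers.
  refine (scripted_congr (Λ := Λ) hN hgap ((c, ∅, ∅) :: h) fun c' hc' d hd => ?_).1
  rcases List.mem_cons.1 hc' with rfl | hc'
  · exact hc d hd
  · exact hinit c' hc' d hd

/-! ### Coincidences -/

/-- The departure of `d` is due at the time `τ` at the end of a script that does not involve the
departure of `d`.
The document `d` need not be in transfer then. -/
def DepartsAt (Λ : (I → ℕ) → I → ℝ) (u : Input I) (d : Doc I) (h : List (Step I)) (τ : ℝ) : Prop :=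
  IsDoc u.N₀ d ∧ (∀ c ∈ h, Avoids u.N₀ d c.1) ∧ (scripted Λ u h).residualAt Λ τ d = 0

lemma exists_departsAt [Nonempty I] (hu : u.Regular) {κ : ℕ} {d : Doc I}
    (hd : d ∈ (path Λ u κ).departing Λ u) :
    ∃ h, path Λ u κ = scripted Λ u h ∧ DepartsAt Λ u d h ((path Λ u κ).nextTime Λ u) := by
  obtain ⟨h, h1, h2⟩ := exists_path_eq_scripted (Λ := Λ) hu κ
  obtain ⟨hact, h0⟩ := State.mem_departing.1 hd
  refine ⟨h, h1, (sound_path hu κ).isDoc d hact, h2 d hact, ?_⟩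
  rw [← h1]
  exact h0

/-- An event at time `t` forces an arrival time, or the end of a service, to hit `t`. -/
lemma OccursAt.arrivalTime_eq_or_departsAt (hu : u.Regular) {t : ℝ} {e : Event I}
    (he : OccursAt Λ u t e) :
    (∃ i m, u.arrivalTime i m = t) ∨ ∃ d h, DepartsAt Λ u d h t := by
  rcases e with d | d
  · obtain ⟨κ, rfl, hd⟩ := he
    exact Or.inl ⟨_, _, (State.mem_arriving.1 hd).1⟩
  · obtain ⟨κ, rfl, hd⟩ := he
    have : Nonempty I := ⟨d.1⟩
    obtain ⟨h, -, hdep⟩ := exists_departsAt hu hd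
    exact Or.inr ⟨d, h, hdep⟩

/-- Two simultaneous events force a coincidence of two arrival times, or the end of a service to hit
the time at which another event is due. -/
lemma OccursAt.eq_or_coincidence (hu : u.Regular) {t : ℝ} {e e' : Event I}
    (he : OccursAt Λ u t e) (he' : OccursAt Λ u t e') :
    e = e' ∨ (∃ i m i' m', i ≠ i' ∧ u.arrivalTime i m = u.arrivalTime i' m') ∨
      ∃ d h c, Avoids u.N₀ d c ∧ DepartsAt Λ u d h ((scripted Λ u h).dueTime Λ u c) := by
  have : Nonempty I := by
    cases e with
    | arrival d => exact ⟨d.1⟩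
    | departure d => exact ⟨d.1⟩
  have hinj := nextTime_path_injective (Λ := Λ) hu
  have hdep : ∀ {κ : ℕ} {d : Doc I} {c : I ⊕ Doc I}, d ∈ (path Λ u κ).departing Λ u →
      (path Λ u κ).dueTime Λ u c = (path Λ u κ).nextTime Λ u → Avoids u.N₀ d c →
      ∃ d h c, Avoids u.N₀ d c ∧ DepartsAt Λ u d h ((scripted Λ u h).dueTime Λ u c) := by
    intro κ d c hd hc hav
    obtain ⟨h, hpath, hdep⟩ := exists_departsAt hu hd
    rw [← hc, hpath] at hdep
    exact ⟨d, h, c, hav, hdep⟩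
  rcases e with d | d <;> rcases e' with d' | d'
  · obtain ⟨κ, rfl, hd⟩ := he
    obtain ⟨κ', hκ, hd'⟩ := he'
    obtain rfl := hinj hκ
    obtain ⟨h1, h2⟩ := State.mem_arriving.1 hd
    obtain ⟨h1', h2'⟩ := State.mem_arriving.1 hd'
    by_cases hi : d.1 = d'.1
    · refine Or.inl (congrArg _ (Prod.ext hi ?_))
      rw [h2, h2', hi]
    · exact Or.inr (Or.inl ⟨_, _, _, _, hi, h1.trans h1'.symm⟩)
  · obtain ⟨κ, rfl, hd⟩ := he
    obtain ⟨κ', hκ, hd'⟩ := he'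
    obtain rfl := hinj hκ
    exact Or.inr (Or.inr (hdep hd' (c := Sum.inl d.1) (State.mem_arriving.1 hd).1
      (by simp [Avoids])))
  · obtain ⟨κ, rfl, hd⟩ := he
    obtain ⟨κ', hκ, hd'⟩ := he'
    obtain rfl := hinj hκ
    exact Or.inr (Or.inr (hdep hd (c := Sum.inl d'.1) (State.mem_arriving.1 hd').1
      (by simp [Avoids])))
  · obtain ⟨κ, rfl, hd⟩ := he
    obtain ⟨κ', hκ, hd'⟩ := he'
    obtain rfl := hinj hκ
    by_cases hne : d = d'
    · exact Or.inl (congrArg _ hne)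
    · have hs : (path Λ u κ').Sound u := sound_path hu κ'
      refine Or.inr (Or.inr (hdep hd (hs.dueTime_eq_nextTime hd') ?_))
      rintro _ ⟨⟩
      exact ⟨Ne.symm hne, hs.isDoc d' (State.mem_departing.1 hd').1⟩

end SamplePath

/-! ### Independence -/

section Independence

variable {Ω : Type*} [MeasurableSpace Ω] {μ : Measure Ω}

/-- A non-atomic coordinate of an independent family almost surely avoids every measurable function
of the other coordinates. -/
lemma ae_ne_of_iIndepFun [IsProbabilityMeasure μ] {ι : Type*} [DecidableEq ι] {Z : ι → Ω → ℝ}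
    (hZ : ∀ i, Measurable (Z i)) (hind : iIndepFun Z μ) {c : ι}
    (hc : ∀ x, μ {ω | Z c ω = x} = 0) {a : (ι → ℝ) → ℝ} (ha : Measurable a) :
    ∀ᵐ ω ∂μ, Z c ω ≠ a (Function.update (fun i => Z i ω) c 0) := by
  set W : Ω → ι → ℝ := fun ω => Function.update (fun i => Z i ω) c 0 with hW
  have hWm : Measurable W := by
    refine measurable_pi_iff.2 fun i => ?_
    by_cases hi : i = c
    · subst hi
      simp [hW]
    · simpa [hW, hi] using hZ i
  have hcW : IndepFun (Z c) W μ := by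
    have h := indep_iSup_of_disjoint (fun i => (hZ i).comap_le) hind
      (S := {c}) (T := {c}ᶜ) disjoint_compl_right
    refine indep_of_indep_of_le_right (indep_of_indep_of_le_left h ?_) ?_
    · exact le_iSup₂_of_le c rfl le_rfl
    · refine Measurable.comap_le ?_
      refine @measurable_pi_iff _ _ _ (_) _ _ |>.2 fun i => ?_
      by_cases hi : i = c
      · subst hi
        simp only [hW, Function.update_self]
        exact measurable_const
      · simp only [hW, Function.update_of_ne hi]
        exact Measurable.mono (comap_measurable (Z i)) (le_iSup₂_of_le i hi le_rfl) le_rfl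
  have hset : MeasurableSet {p : ℝ × (ι → ℝ) | p.1 = a p.2} :=
    measurableSet_eq_fun measurable_fst (ha.comp measurable_snd)
  have hnull : (μ.map fun ω => (Z c ω, W ω)) {p | p.1 = a p.2} = 0 := by
    have := Measure.isProbabilityMeasure_map (μ := μ) hWm.aemeasurable
    have := Measure.isProbabilityMeasure_map (μ := μ) (hZ c).aemeasurable
    rw [hcW.map_prod_eq_prod_map_map (hZ c).aemeasurable hWm.aemeasurable,
      Measure.prod_apply_symm hset]
    refine (lintegral_congr fun w => ?_).trans lintegral_zero
    rw [Measure.map_apply (hZ c) (measurable_prodMk_right hset)]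
    exact hc (a w)
  rw [Measure.map_apply ((hZ c).prodMk hWm) hset] at hnull
  exact measure_eq_zero_iff_ae_notMem.1 hnull

/-- Two independent families that are independent of each other form an independent family. -/
lemma iIndepFun_sumElim {ι κ : Type*} {Y : ι → Ω → ℝ} {W : κ → Ω → ℝ} (hY : iIndepFun Y μ)
    (hW : iIndepFun W μ) (hYW : IndepFun (fun ω i => Y i ω) (fun ω k => W k ω) μ) :
    iIndepFun (Sum.elim Y W) μ := by
  classical
  rw [iIndepFun_iff_measure_inter_preimage_eq_mul]
  intro S sets hS
  have hinl : ∀ i ∈ S.toLeft, MeasurableSet (sets (Sum.inl i)) :=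
    fun i hi => hS _ (Finset.mem_toLeft.1 hi)
  have hinr : ∀ k ∈ S.toRight, MeasurableSet (sets (Sum.inr k)) :=
    fun k hk => hS _ (Finset.mem_toRight.1 hk)
  have hsplit : (⋂ c ∈ S, (Sum.elim Y W c) ⁻¹' sets c) =
      (fun ω i => Y i ω) ⁻¹' (⋂ i ∈ S.toLeft, (fun y => y i) ⁻¹' sets (Sum.inl i)) ∩
      (fun ω k => W k ω) ⁻¹' (⋂ k ∈ S.toRight, (fun y => y k) ⁻¹' sets (Sum.inr k)) := by
    ext ω
    simp
  rw [hsplit, hYW.measure_inter_preimage_eq_mul _ _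
    (Finset.measurableSet_biInter _ fun i hi => measurable_pi_apply i (hinl i hi))
    (Finset.measurableSet_biInter _ fun k hk => measurable_pi_apply k (hinr k hk))]
  simp only [Set.preimage_iInter, Set.preimage_preimage]
  rw [hY.measure_inter_preimage_eq_mul _ hinl, hW.measure_inter_preimage_eq_mul _ hinr]
  conv_rhs => rw [← S.toLeft_disjSum_toRight, Finset.prod_disjSum]
  rfl

variable {α β : Type*} [MeasurableSpace α] [MeasurableSpace β] {A : Ω → α} {W : Ω → β} {s : Set α}

/-- Conditioning on an event independent of `W` does not change the law of `W`. -/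
lemma cond_preimage_of_indepFun [IsFiniteMeasure μ] (hA : Measurable A) (h : IndepFun A W μ)
    (hs : MeasurableSet s) (hμs : μ (A ⁻¹' s) ≠ 0) {b : Set β} (hb : MeasurableSet b) :
    cond μ (A ⁻¹' s) (W ⁻¹' b) = μ (W ⁻¹' b) := by
  rw [cond_apply (hA hs), h.measure_inter_preimage_eq_mul _ _ hs hb, ← mul_assoc,
    ENNReal.inv_mul_cancel hμs (measure_ne_top _ _), one_mul]

lemma indepFun_cond_of_indepFun [IsFiniteMeasure μ] (hA : Measurable A) (h : IndepFun A W μ)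
    (hs : MeasurableSet s) (hμs : μ (A ⁻¹' s) ≠ 0) : IndepFun A W (cond μ (A ⁻¹' s)) := by
  rw [indepFun_iff_measure_inter_preimage_eq_mul]
  intro a b ha hb
  rw [cond_preimage_of_indepFun hA h hs hμs hb, cond_apply (hA hs), cond_apply (hA hs),
    ← Set.inter_assoc, ← Set.preimage_inter,
    h.measure_inter_preimage_eq_mul _ _ (hs.inter ha) hb, mul_assoc]

lemma iIndepFun_cond_of_indepFun [IsFiniteMeasure μ] {κ : Type*} {W : κ → Ω → ℝ}
    (hA : Measurable A) (h : IndepFun A (fun ω k => W k ω) μ) (hW : iIndepFun W μ)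
    (hs : MeasurableSet s) (hμs : μ (A ⁻¹' s) ≠ 0) : iIndepFun W (cond μ (A ⁻¹' s)) := by
  rw [iIndepFun_iff_measure_inter_preimage_eq_mul]
  intro S sets hS
  have hprod : ∀ k ∈ S, cond μ (A ⁻¹' s) (W k ⁻¹' sets k) = μ (W k ⁻¹' sets k) := fun k hk =>
    cond_preimage_of_indepFun hA h hs hμs (measurable_pi_apply k (hS k hk))
  have hinter : (⋂ k ∈ S, W k ⁻¹' sets k) =
      (fun ω k => W k ω) ⁻¹' ⋂ k ∈ S, (fun y => y k) ⁻¹' sets k := by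
    ext ω
    simp
  rw [Finset.prod_congr rfl hprod, ← hW.measure_inter_preimage_eq_mul S hS, hinter]
  exact cond_preimage_of_indepFun hA h hs hμs
    (Finset.measurableSet_biInter _ fun k hk => measurable_pi_apply k (hS k hk))

/-- An assertion holds almost surely if it does so conditionally on each value of a discrete
variable. -/
lemma ae_of_forall_ae_cond [IsFiniteMeasure μ] [Countable α] [MeasurableSingletonClass α]
    (hA : Measurable A) {p : Ω → Prop}
    (h : ∀ n, μ (A ⁻¹' {n}) ≠ 0 → ∀ᵐ ω ∂cond μ (A ⁻¹' {n}), p ω) : ∀ᵐ ω ∂μ, p ω := by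
  have H : ∀ n, ∀ᵐ ω ∂μ, A ω = n → p ω := by
    intro n
    by_cases hn : μ (A ⁻¹' {n}) = 0
    · filter_upwards [measure_eq_zero_iff_ae_notMem.1 hn] with ω hω hA
      exact absurd hA hω
    · have h0 := ae_iff.1 (h n hn)
      rw [cond_apply (hA (measurableSet_singleton n)), mul_eq_zero] at h0
      have h1 := h0.resolve_left (ENNReal.inv_ne_zero.2 (measure_ne_top _ _))
      filter_upwards [measure_eq_zero_iff_ae_notMem.1 h1] with ω hω hA
      by_contra hp
      exact hω ⟨hA, hp⟩
  filter_upwards [ae_all_iff.2 H] with ω hω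
  exact hω _ rfl

end Independence

/-! ### Coordinates of the input -/

section Coordinates

variable {I : Type*}

/-- The random coordinates of an input with `n i` initial documents on each route `i`: the residual
sizes of the initial documents, the inter-arrival times, and the sizes of the arriving documents. -/
abbrev Coord (n : I → ℕ) := {p : I × ℕ // p.2 < n p.1} ⊕ ((I × ℕ) ⊕ (I × ℕ))

/-- The input `u` has `n i` initial documents on each route `i`, and coordinates `z`. The entries
`u.y₀ i k` with `n i ≤ k` are arbitrary. -/
structure Input.HasCoords (u : Input I) (n : I → ℕ) (z : Coord n → ℝ) : Prop where
  N₀_eq : u.N₀ = n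
  y₀_eq : ∀ i k (h : k < n i), u.y₀ i k = z (Sum.inl ⟨(i, k), h⟩)
  gap_eq : ∀ i m, u.gap i m = z (Sum.inr (Sum.inl (i, m)))
  size_eq : ∀ i m, u.size i m = z (Sum.inr (Sum.inr (i, m)))

/-- The input with coordinates `z` and with the entry `0` for every void label. -/
def Input.ofCoords (n : I → ℕ) (z : Coord n → ℝ) : Input I where
  N₀ := n
  y₀ i k := if h : k < n i then z (Sum.inl ⟨(i, k), h⟩) else 0
  gap i m := z (Sum.inr (Sum.inl (i, m)))
  size i m := z (Sum.inr (Sum.inr (i, m)))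

lemma Input.hasCoords_ofCoords (n : I → ℕ) (z : Coord n → ℝ) :
    (Input.ofCoords n z).HasCoords n z where
  N₀_eq := rfl
  y₀_eq i k h := by simp [Input.ofCoords, h]
  gap_eq _ _ := rfl
  size_eq _ _ := rfl

lemma Input.HasCoords.regular {u : Input I} {n : I → ℕ} {z : Coord n → ℝ} (h : u.HasCoords n z)
    (hgap : ∀ p, 0 < z (Sum.inr (Sum.inl p))) (hz : ∀ c, z c ≠ 0) : u.Regular where
  gap_pos i m := by
    rw [h.gap_eq]
    exact hgap _
  size_ne_zero i m := by
    rw [h.size_eq]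
    exact hz _
  y₀_ne_zero i k hk := by
    rw [h.N₀_eq] at hk
    rw [h.y₀_eq i k hk]
    exact hz _

lemma Input.HasCoords.arrivalTime_eq {u : Input I} {n : I → ℕ} {z : Coord n → ℝ}
    (h : u.HasCoords n z) (i : I) (m : ℕ) :
    u.arrivalTime i m = ∑ l ∈ Finset.range (m + 1), z (Sum.inr (Sum.inl (i, l))) :=
  Finset.sum_congr rfl fun l _ => h.gap_eq i l

lemma Input.measurable_arrivalTime_ofCoords {n : I → ℕ} (i : I) (m : ℕ) :
    Measurable fun z : Coord n → ℝ => (Input.ofCoords n z).arrivalTime i m :=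
  Finset.measurable_fun_sum _ fun _ _ => measurable_pi_apply _

lemma State.measurable_residualAt {Λ : (I → ℕ) → I → ℝ} {α : Type*} [MeasurableSpace α]
    {s : α → State I}
    (hact : ∀ x y, (s x).active = (s y).active) (htime : Measurable fun x => (s x).time)
    (hres : ∀ d, Measurable fun x => (s x).residual d) {τ : α → ℝ} (hτ : Measurable τ)
    (d : Doc I) : Measurable fun x => (s x).residualAt Λ (τ x) d := by
  rcases isEmpty_or_nonempty α with _ | ⟨⟨x₀⟩⟩
  · exact measurable_of_empty _
  by_cases hd : d ∈ (s x₀).active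
  · have heq : ∀ x, (s x).residualAt Λ (τ x) d =
        (s x).residual d - (s x₀).rate Λ d * (τ x - (s x).time) := fun x => by
      rw [State.residualAt, if_pos (hact x₀ x ▸ hd), State.rate_congr (hact x x₀)]
    simp only [heq]
    exact (hres d).sub ((hτ.sub htime).const_mul _)
  · have heq : ∀ x, (s x).residualAt Λ (τ x) d = (s x).residual d := fun x => by
      rw [State.residualAt, if_neg (hact x₀ x ▸ hd)]
    simp only [heq]
    exact hres d

lemma State.measurable_dueTime {n : I → ℕ} {Λ : (I → ℕ) → I → ℝ}
    {s : (Coord n → ℝ) → State I} (harr : ∀ z z', (s z).arrived = (s z').arrived)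
    (hact : ∀ z z', (s z).active = (s z').active)
    (htime : Measurable fun z => (s z).time) (hres : ∀ d, Measurable fun z => (s z).residual d)
    (c : I ⊕ Doc I) : Measurable fun z => (s z).dueTime Λ (Input.ofCoords n z) c := by
  rcases c with i | d
  · simp only [State.dueTime, harr _ 0]
    exact Input.measurable_arrivalTime_ofCoords i _
  · simp only [State.dueTime, State.rate_congr (hact _ 0)]
    exact htime.add ((hres d).div_const _)

variable [Fintype I]

/-- The inputs `u` and `v` with `n i` initial documents on each route `i` differ at most in the size
of the document `d`, and in the meaningless sizes of void labels. -/
structure AgreeOff (n : I → ℕ) (d : Doc I) (u v : Input I) : Prop where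
  left_N₀ : u.N₀ = n
  right_N₀ : v.N₀ = n
  gap_eq : u.gap = v.gap
  residual_eq : ∀ d', d' ≠ d → IsDoc n d' → u.initial.residual d' = v.initial.residual d'

variable {n : I → ℕ} {d : Doc I} {Λ : (I → ℕ) → I → ℝ} {u v : Input I}

/-- The size of a document is one of the coordinates, and changing this coordinate changes nothing
else. -/
lemma IsDoc.exists_coord [DecidableEq (Coord n)] (hd : IsDoc n d) : ∃ c : Coord n,
    (∀ (u : Input I) z, u.HasCoords n z → u.initial.residual d = z c) ∧
      ∀ (u v : Input I) z x, u.HasCoords n z → v.HasCoords n (Function.update z c x) →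
        AgreeOff n d u v := by
  obtain ⟨i, k | m⟩ := d
  · refine ⟨Sum.inl ⟨(i, k), hd k rfl⟩, fun u z hu => hu.y₀_eq i k _, fun u v z x hu hv =>
      ⟨hu.N₀_eq, hv.N₀_eq, ?_, ?_⟩⟩
    · funext j l
      rw [hu.gap_eq, hv.gap_eq, Function.update_of_ne (by simp)]
    · rintro ⟨j, l | l⟩ hne hd'
      · have hl : l < n j := hd' l rfl
        change u.y₀ j l = v.y₀ j l
        rw [hu.y₀_eq j l hl, hv.y₀_eq j l hl, Function.update_of_ne (by simpa using hne)]
      · change u.size j l = v.size j l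
        rw [hu.size_eq, hv.size_eq, Function.update_of_ne (by simp)]
  · refine ⟨Sum.inr (Sum.inr (i, m)), fun u z hu => hu.size_eq i m, fun u v z x hu hv =>
      ⟨hu.N₀_eq, hv.N₀_eq, ?_, ?_⟩⟩
    · funext j l
      rw [hu.gap_eq, hv.gap_eq, Function.update_of_ne (by simp)]
    · rintro ⟨j, l | l⟩ hne hd'
      · have hl : l < n j := hd' l rfl
        change u.y₀ j l = v.y₀ j l
        rw [hu.y₀_eq j l hl, hv.y₀_eq j l hl, Function.update_of_ne (by simp)]
      · change u.size j l = v.size j l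
        rw [hu.size_eq, hv.size_eq, Function.update_of_ne (by simpa using hne)]

/-- The departure of `d` at a time that does not depend on the size of `d` determines this size. -/
lemma DepartsAt.residual_initial_eq {h : List (Step I)} {τ : ℝ} (hd : DepartsAt Λ u d h τ)
    (huv : AgreeOff n d u v) (hv : v.initial.residual d = 0) :
    u.initial.residual d = -(scripted Λ v h).residualAt Λ τ d := by
  obtain ⟨-, hav, h0⟩ := hd
  have := residualAt_scripted_congr (Λ := Λ) (huv.left_N₀.trans huv.right_N₀.symm) huv.gap_eq h
    (fun c hc d' hd' => huv.residual_eq d' (hav c hc d' hd').1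
      (huv.left_N₀ ▸ (hav c hc d' hd').2)) τ d
  linarith

lemma DepartsAt.dueTime_eq {h : List (Step I)} {τ : ℝ} (hd : DepartsAt Λ u d h τ)
    (huv : AgreeOff n d u v) {c : I ⊕ Doc I} (hc : Avoids u.N₀ d c) :
    (scripted Λ u h).dueTime Λ u c = (scripted Λ v h).dueTime Λ v c :=
  dueTime_scripted_congr (huv.left_N₀.trans huv.right_N₀.symm) huv.gap_eq h
    (fun c' hc' d' hd' => huv.residual_eq d' (hd.2.1 c' hc' d' hd').1
      (huv.left_N₀ ▸ (hd.2.1 c' hc' d' hd').2)) c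
    fun d' hd' => huv.residual_eq d' (hc d' hd').1 (huv.left_N₀ ▸ (hc d' hd').2)

/-- The combinatorial part of a scripted state depends only on the script and on the initial numbers
of documents. -/
lemma scripted_ofCoords_congr (h : List (Step I)) (z z' : Coord n → ℝ) :
    (scripted Λ (Input.ofCoords n z) h).arrived = (scripted Λ (Input.ofCoords n z') h).arrived ∧
      (scripted Λ (Input.ofCoords n z) h).active = (scripted Λ (Input.ofCoords n z') h).active := by
  induction h with
  | nil => exact ⟨rfl, rfl⟩
  | cons c h ih => simp only [scripted, State.follow, ih.1, ih.2, and_self]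

lemma Input.measurable_residual_ofCoords (d : Doc I) :
    Measurable fun z : Coord n → ℝ => (Input.ofCoords n z).initial.residual d := by
  obtain ⟨i, k | m⟩ := d
  · simp only [Input.initial, Input.ofCoords]
    split_ifs
    · exact measurable_pi_apply _
    · exact measurable_const
  · exact measurable_pi_apply _

lemma measurable_scripted (h : List (Step I)) :
    (Measurable fun z : Coord n → ℝ => (scripted Λ (Input.ofCoords n z) h).time) ∧
      ∀ d, Measurable fun z : Coord n → ℝ =>
        (scripted Λ (Input.ofCoords n z) h).residual d := by
  induction h with
  | nil => exact ⟨measurable_const, Input.measurable_residual_ofCoords⟩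
  | cons c h ih =>
    have hdue := State.measurable_dueTime (Λ := Λ) (fun z z' => (scripted_ofCoords_congr h z z').1)
      (fun z z' => (scripted_ofCoords_congr h z z').2) ih.1 ih.2 c.1
    exact ⟨hdue, State.measurable_residualAt (fun z z' => (scripted_ofCoords_congr h z z').2)
      ih.1 ih.2 hdue⟩

lemma measurable_dueTime_scripted (h : List (Step I)) (c : I ⊕ Doc I) :
    Measurable fun z : Coord n → ℝ =>
      (scripted Λ (Input.ofCoords n z) h).dueTime Λ (Input.ofCoords n z) c :=
  State.measurable_dueTime (fun z z' => (scripted_ofCoords_congr h z z').1)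
    (fun z z' => (scripted_ofCoords_congr h z z').2) (measurable_scripted h).1
    (measurable_scripted h).2 c

lemma measurable_residualAt_scripted (h : List (Step I)) {τ : (Coord n → ℝ) → ℝ}
    (hτ : Measurable τ) (d : Doc I) : Measurable fun z : Coord n → ℝ =>
      (scripted Λ (Input.ofCoords n z) h).residualAt Λ (τ z) d :=
  State.measurable_residualAt (fun z z' => (scripted_ofCoords_congr h z z').2)
    (measurable_scripted h).1 (measurable_scripted h).2 hτ d

end Coordinates

/-! ### Coincidences are null events -/

section AlmostSure

variable {I : Type*} {Ω : Type*} [MeasurableSpace Ω] {μ : Measure Ω} [IsProbabilityMeasure μ]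
  {n : I → ℕ} {Z : Coord n → Ω → ℝ} {u : Ω → Input I}

/-- Almost surely, the `m`-th arrival time of route `i` avoids any random time that does not depend
on the inter-arrival times of this route. -/
lemma ae_arrivalTime_ne (hZ : ∀ c, Measurable (Z c)) (hind : iIndepFun Z μ)
    (hna : ∀ c x, μ {ω | Z c ω = x} = 0) (hu : ∀ᵐ ω ∂μ, (u ω).HasCoords n fun c => Z c ω)
    (i : I) (m : ℕ) {τ : Input I → ℝ} (hτ : Measurable fun z => τ (Input.ofCoords n z))
    (hτ' : ∀ v w : Input I, (∀ j, j ≠ i → v.gap j = w.gap j) → τ v = τ w) :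
    ∀ᵐ ω ∂μ, (u ω).arrivalTime i m ≠ τ (u ω) := by
  classical
  set c : Coord n := Sum.inr (Sum.inl (i, m)) with hc
  have ha := hτ.sub (Input.measurable_arrivalTime_ofCoords (n := n) i m)
  filter_upwards [hu, ae_ne_of_iIndepFun hZ hind (hna c) ha] with ω hω hne heq
  refine hne ?_
  set v := Input.ofCoords n (Function.update (fun c => Z c ω) c 0)
  have hvc : v.HasCoords n _ := Input.hasCoords_ofCoords n _
  have hτv : τ (u ω) = τ v := hτ' _ _ fun j hj => by
    funext l
    rw [hω.gap_eq, hvc.gap_eq, Function.update_of_ne (by simp [hc, hj])]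
  have hsum : (u ω).arrivalTime i m = v.arrivalTime i m + Z c ω := by
    rw [hω.arrivalTime_eq, hvc.arrivalTime_eq, Finset.sum_range_succ, Finset.sum_range_succ,
      ← hc, Function.update_self, add_zero]
    congr 1
    refine Finset.sum_congr rfl fun l hl => ?_
    rw [Function.update_of_ne]
    simpa [hc] using (Finset.mem_range.1 hl).ne
  change Z c ω = τ v - v.arrivalTime i m
  linarith

variable [Fintype I] {Λ : (I → ℕ) → I → ℝ}

/-- Almost surely, a document can depart at the end of a script at the time `τ` only if `τ` depends
on its size: some input `v` that differs only in this size (and in void labels) has another `τ`. -/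
lemma ae_not_departsAt (hZ : ∀ c, Measurable (Z c)) (hind : iIndepFun Z μ)
    (hna : ∀ c x, μ {ω | Z c ω = x} = 0) (hu : ∀ᵐ ω ∂μ, (u ω).HasCoords n fun c => Z c ω)
    (d : Doc I) (h : List (Step I)) {τ : Input I → ℝ}
    (hτ : Measurable fun z => τ (Input.ofCoords n z)) :
    ∀ᵐ ω ∂μ, DepartsAt Λ (u ω) d h (τ (u ω)) → ∃ v, AgreeOff n d (u ω) v ∧ τ (u ω) ≠ τ v := by
  classical
  by_cases hd : IsDoc n d
  · obtain ⟨c, hc, hagree⟩ := hd.exists_coord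
    have ha := (measurable_residualAt_scripted (Λ := Λ) h hτ d).neg
    filter_upwards [hu, ae_ne_of_iIndepFun hZ hind (hna c) ha] with ω hω hne hdep
    set v := Input.ofCoords n (Function.update (fun c => Z c ω) c 0)
    have hvc := Input.hasCoords_ofCoords n (Function.update (fun c => Z c ω) c 0)
    have huv := hagree _ v _ _ hω hvc
    refine ⟨v, huv, fun heq => hne ?_⟩
    have := hdep.residual_initial_eq huv (by rw [hc v _ hvc, Function.update_self])
    rw [hc _ _ hω, heq] at this
    exact this
  · filter_upwards [hu] with ω hω hdep
    exact absurd (hω.N₀_eq ▸ hdep.1) hd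

/-- With independent non-atomic coordinates and positive inter-arrival times, there are almost
surely no simultaneous events, and no event at a fixed time. -/
theorem ae_no_coincidence (hZ : ∀ c, Measurable (Z c)) (hind : iIndepFun Z μ)
    (hna : ∀ c x, μ {ω | Z c ω = x} = 0)
    (hgap : ∀ p, ∀ᵐ ω ∂μ, 0 < Z (Sum.inr (Sum.inl p)) ω)
    (hu : ∀ᵐ ω ∂μ, (u ω).HasCoords n fun c => Z c ω) :
    (∀ᵐ ω ∂μ, ∀ (t : ℝ) (e e' : Event I),
      OccursAt Λ (u ω) t e → OccursAt Λ (u ω) t e' → e = e') ∧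
    ∀ t : ℝ, ∀ᵐ ω ∂μ, ∀ e : Event I, ¬ OccursAt Λ (u ω) t e := by
  have hreg : ∀ᵐ ω ∂μ, (u ω).Regular := by
    have hne : ∀ c, ∀ᵐ ω ∂μ, Z c ω ≠ 0 := fun c => measure_eq_zero_iff_ae_notMem.1 (hna c 0)
    filter_upwards [hu, ae_all_iff.2 hgap, ae_all_iff.2 hne] with ω hω h1 h2
    exact hω.regular h1 h2
  constructor
  · have harr : ∀ᵐ ω ∂μ, ∀ i m i' m', i ≠ i' →
        (u ω).arrivalTime i m ≠ (u ω).arrivalTime i' m' := by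
      simp only [ae_all_iff]
      intro i m i' m' hne
      refine ae_arrivalTime_ne hZ hind hna hu i m (τ := fun v => v.arrivalTime i' m')
        (Input.measurable_arrivalTime_ofCoords i' m') fun v w hvw => ?_
      simp only [Input.arrivalTime, hvw i' hne.symm]
    have hdep : ∀ᵐ ω ∂μ, ∀ d h c,
        DepartsAt Λ (u ω) d h ((scripted Λ (u ω) h).dueTime Λ (u ω) c) →
        ∃ v, AgreeOff n d (u ω) v ∧
          (scripted Λ (u ω) h).dueTime Λ (u ω) c ≠ (scripted Λ v h).dueTime Λ v c := by
      simp only [ae_all_iff]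
      exact fun d h c => ae_not_departsAt hZ hind hna hu d h
        (τ := fun v => (scripted Λ v h).dueTime Λ v c) (measurable_dueTime_scripted h c)
    filter_upwards [hreg, harr, hdep] with ω h1 h2 h3 t e e' he he'
    rcases he.eq_or_coincidence h1 he' with h | ⟨i, m, i', m', hne, h⟩ | ⟨d, h, c, hc, hd⟩
    · exact h
    · exact absurd h (h2 i m i' m' hne)
    · obtain ⟨v, huv, hne⟩ := h3 d h c hd
      exact absurd (hd.dueTime_eq huv hc) hne
  · intro t
    have harr : ∀ᵐ ω ∂μ, ∀ i m, (u ω).arrivalTime i m ≠ t := by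
      simp only [ae_all_iff]
      exact fun i m => ae_arrivalTime_ne hZ hind hna hu i m (τ := fun _ => t) measurable_const
        fun _ _ _ => rfl
    have hdep : ∀ᵐ ω ∂μ, ∀ d h, DepartsAt Λ (u ω) d h t → ∃ v, AgreeOff n d (u ω) v ∧ t ≠ t := by
      simp only [ae_all_iff]
      exact fun d h => ae_not_departsAt hZ hind hna hu d h (τ := fun _ => t) measurable_const
    filter_upwards [hreg, harr, hdep] with ω h1 h2 h3 e he
    rcases he.arrivalTime_eq_or_departsAt h1 with ⟨i, m, h⟩ | ⟨d, h, hd⟩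
    · exact h2 i m h
    · obtain ⟨-, -, hne⟩ := h3 d h hd
      exact hne rfl

end AlmostSure

/-! ### Mixing over the initial state -/

lemma expMeasure_singleton (r x : ℝ) : expMeasure r {x} = 0 :=
  withDensity_absolutelyContinuous _ _ (measure_singleton x)

lemma expMeasure_Iic_zero (r : ℝ) : expMeasure r (Set.Iic 0) = 0 := by
  rw [← Set.Iio_union_right, measure_union_null_iff]
  refine ⟨?_, expMeasure_singleton r 0⟩
  rw [expMeasure, gammaMeasure, withDensity_apply _ measurableSet_Iio]
  exact lintegral_gammaPDF_of_nonpos le_rfl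

/-- Given the initial numbers of documents, the coordinates of the input are independent. -/
lemma iIndepFun_coord_cond {I : Type*} [Countable I] {Ω : Type*} [MeasurableSpace Ω] {P : Measure Ω}
    [IsProbabilityMeasure P] {N₀ : Ω → I → ℕ} (hN₀ : Measurable N₀) {Y₀ : Ω → I → ℕ → ℝ}
    (hY₀ : Measurable Y₀) {W : (I × ℕ) ⊕ (I × ℕ) → Ω → ℝ} (hW : iIndepFun W P)
    (h_indep : IndepFun (fun ω => (N₀ ω, Y₀ ω)) (fun ω p => W p ω) P) {n : I → ℕ}
    (hn : P (N₀ ⁻¹' {n}) ≠ 0)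
    (hY₀_indep : iIndepFun (fun (p : {p : I × ℕ // p.2 < n p.1}) ω => Y₀ ω p.1.1 p.1.2)
        (cond P (N₀ ⁻¹' {n}))) :
    iIndepFun (Sum.elim (fun (p : {p : I × ℕ // p.2 < n p.1}) ω => Y₀ ω p.1.1 p.1.2) W)
      (cond P (N₀ ⁻¹' {n})) := by
  have hA : Measurable fun ω => (N₀ ω, Y₀ ω) := hN₀.prodMk hY₀
  have hs : MeasurableSet (Prod.fst ⁻¹' {n} : Set ((I → ℕ) × (I → ℕ → ℝ))) :=
    measurable_fst (measurableSet_singleton n)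
  have hfib : N₀ ⁻¹' {n} = (fun ω => (N₀ ω, Y₀ ω)) ⁻¹' (Prod.fst ⁻¹' {n}) := rfl
  rw [hfib] at hn hY₀_indep ⊢
  refine iIndepFun_sumElim hY₀_indep (iIndepFun_cond_of_indepFun hA h_indep hW hs hn) ?_
  refine (indepFun_cond_of_indepFun hA h_indep hs hn).comp
    (φ := fun q (p : {p : I × ℕ // p.2 < n p.1}) => q.2 p.1.1 p.1.2) (ψ := id) ?_ measurable_id
  fun_prop

end SpinningNet

theorem lemma6p2 {I J : Type*} [Fintype I] [Fintype J] (Q : SpinningNet.QueueNetwork I J)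
    {Ω : Type*} [MeasurableSpace Ω] (P : Measure Ω) [IsProbabilityMeasure P]
    -- arrival rates and document size distributions
    (ν : I → ℝ) (hν : ∀ i, 0 < ν i)
    (sizeLaw : I → Measure ℝ) (hsize_pos : ∀ i, sizeLaw i (Set.Iic 0) = 0)
    (hsize_mean : ∀ i, Integrable (fun x : ℝ => x) (sizeLaw i))
    (hsize_nonatomic : ∀ i x, sizeLaw i {x} = 0)
    -- initial numbers of documents and their residual sizes
    (N₀ : Ω → I → ℕ) (hN₀ : Measurable N₀)
    (Y₀ : Ω → I → ℕ → ℝ) (hY₀ : Measurable Y₀)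
    (hY₀_pos : ∀ᵐ ω ∂P, ∀ i, ∀ k < N₀ ω i, 0 < Y₀ ω i k)
    (hY₀_indep : ∀ n : I → ℕ, P (N₀ ⁻¹' {n}) ≠ 0 →
      iIndepFun (fun (p : {p : I × ℕ // p.2 < n p.1}) (ω : Ω) => Y₀ ω p.1.1 p.1.2)
        (cond P (N₀ ⁻¹' {n})))
    (hY₀_nonatomic : ∀ n : I → ℕ, P (N₀ ⁻¹' {n}) ≠ 0 →
      ∀ i, ∀ k < n i, ∀ x : ℝ, cond P (N₀ ⁻¹' {n}) {ω | Y₀ ω i k = x} = 0)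
    -- inter-arrival times and sizes of the arriving documents
    (ξ X : I × ℕ → Ω → ℝ)
    (hξ : ∀ p, HasLaw (ξ p) (expMeasure (ν p.1)) P)
    (hX : ∀ p, HasLaw (X p) (sizeLaw p.1) P)
    (hξX_indep : iIndepFun (Sum.elim ξ X) P)
    (h_indep : IndepFun (fun ω => (N₀ ω, Y₀ ω)) (fun ω => (fun p => ξ p ω, fun p => X p ω)) P)
    -- the sample paths of the spinning network
    (u : Ω → SpinningNet.Input I)
    (hu : ∀ ω, u ω = ⟨N₀ ω, Y₀ ω, fun i m => ξ (i, m) ω, fun i m => X (i, m) ω⟩) :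
    (∀ᵐ ω ∂P, ∀ (t : ℝ) (e e' : SpinningNet.Event I),
      SpinningNet.OccursAt Q.spinningAllocation (u ω) t e →
      SpinningNet.OccursAt Q.spinningAllocation (u ω) t e' → e = e') ∧
    (∀ t : ℝ, 0 ≤ t → ∀ᵐ ω ∂P, ∀ e : SpinningNet.Event I,
      ¬ SpinningNet.OccursAt Q.spinningAllocation (u ω) t e) := by
  -- The inter-arrival times and sizes are only a.e. measurable: pass to measurable modifications.
  have hW : ∀ p, AEMeasurable (Sum.elim ξ X p) P := by
    rintro (p | p)
    · exact (hξ p).aemeasurable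
    · exact (hX p).aemeasurable
  set W : (I × ℕ) ⊕ (I × ℕ) → Ω → ℝ := fun p => (hW p).mk _
  have hWm : ∀ p, Measurable (W p) := fun p => (hW p).measurable_mk
  have hWae : ∀ᵐ ω ∂P, ∀ p, Sum.elim ξ X p ω = W p ω := ae_all_iff.2 fun p => (hW p).ae_eq_mk
  have hWind : iIndepFun W P := hξX_indep.congr fun p => (hW p).ae_eq_mk
  have hW_indep : IndepFun (fun ω => (N₀ ω, Y₀ ω)) (fun ω p => W p ω) P := by
    have h := h_indep.comp (φ := id)
      (ψ := fun (q : (I × ℕ → ℝ) × (I × ℕ → ℝ)) (p : (I × ℕ) ⊕ (I × ℕ)) => Sum.elim q.1 q.2 p)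
      measurable_id (measurable_pi_iff.2 (by rintro (p | p) <;> simp only [Sum.elim] <;> fun_prop))
    refine h.congr Filter.EventuallyEq.rfl ?_
    filter_upwards [hWae] with ω hω
    funext p
    rw [← hω p]
    cases p <;> rfl
  have hW_nonatomic : ∀ p x, P (W p ⁻¹' {x}) = 0 := by
    intro p x
    rw [← Measure.map_apply (hWm p) (measurableSet_singleton x),
      ← Measure.map_congr (hW p).ae_eq_mk]
    rcases p with p | p
    · exact (hξ p).map_eq ▸ SpinningNet.expMeasure_singleton _ x
    · exact (hX p).map_eq ▸ hsize_nonatomic _ x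
  have hgap : ∀ p, ∀ᵐ ω ∂P, 0 < W (Sum.inl p) ω := by
    intro p
    have h0 : P (W (Sum.inl p) ⁻¹' Set.Iic 0) = 0 := by
      rw [← Measure.map_apply (hWm _) measurableSet_Iic, ← Measure.map_congr (hW _).ae_eq_mk]
      exact (hξ p).map_eq ▸ SpinningNet.expMeasure_Iic_zero _
    filter_upwards [measure_eq_zero_iff_ae_notMem.1 h0] with ω hω
    simpa using hω
  have key : ∀ n, P (N₀ ⁻¹' {n}) ≠ 0 →
      (∀ᵐ ω ∂cond P (N₀ ⁻¹' {n}), ∀ (t : ℝ) (e e' : SpinningNet.Event I),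
        SpinningNet.OccursAt Q.spinningAllocation (u ω) t e →
        SpinningNet.OccursAt Q.spinningAllocation (u ω) t e' → e = e') ∧
      ∀ t : ℝ, ∀ᵐ ω ∂cond P (N₀ ⁻¹' {n}), ∀ e : SpinningNet.Event I,
        ¬ SpinningNet.OccursAt Q.spinningAllocation (u ω) t e := by
    intro n hn
    have := cond_isProbabilityMeasure hn
    have hac : cond P (N₀ ⁻¹' {n}) ≪ P := cond_absolutelyContinuous
    refine SpinningNet.ae_no_coincidence ?_
      (SpinningNet.iIndepFun_coord_cond hN₀ hY₀ hWind hW_indep hn (hY₀_indep n hn)) ?_ ?_ ?_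
    · rintro (p | p)
      · simp only [Sum.elim_inl]
        fun_prop
      · exact hWm p
    · rintro (p | p) x
      · exact hY₀_nonatomic n hn _ _ p.2 x
      · exact hac (hW_nonatomic p x)
    · exact fun p => hac.ae_le (hgap p)
    · filter_upwards [hac.ae_le hWae, ae_cond_mem (hN₀ (measurableSet_singleton n))] with ω hω hN
      rw [hu]
      exact ⟨hN, fun _ _ _ => rfl, fun i m => hω (Sum.inl (i, m)), fun i m => hω (Sum.inr (i, m))⟩
  exact ⟨SpinningNet.ae_of_forall_ae_cond hN₀ fun n hn => (key n hn).1,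
    fun t _ => SpinningNet.ae_of_forall_ae_cond hN₀ fun n hn => (key n hn).2 t⟩
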